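/- For positive integers $n,d$ let $\mathcal D=\{-1/\sqrt d,\,1/\sqrt d\}^d\subset\mathbb R^d$, and for a dataset $D=(x_1,\dots,x_n)\in\mathcal D^n$ let $\bar D=\frac1n\sum_{i=1}^n x_i$. A mechanism $\mathcal M$ assigns to each $D\in\mathcal D^n$ a random vector $\mathcal M(D)$ in $\mathbb R^d$; it is $(\varepsilon,\delta)$-DP if $\mathbb P[\mathcal M(D)\in S]\le e^{\varepsilon}\,\mathbb P[\mathcal M(D')\in S]+\delta$ for all measurable $S\subseteq\mathbb R^d$ and all $D,D'\in\mathcal D^n$ that differ in at most one of the $n$ records. There are absolute constants $\kappa,c>0$ such that the following holds for all integers $n,d\ge1$, all $0<\varepsilon\le\kappa d$ (in particular for all $\varepsilon\le\kappa$ in every dimension, and, for any constant $C$, for all $\varepsilon\le C$ once $d\ge C/\kappa$), and all $$\delta\in\Bigl(\exp\bigl(-4d\log(d)\log^2(nd)\bigr),\ 4\,n^{-d}\log^{-2d}(8d)\Bigr).$$ For every $(\varepsilon,\delta)$-DP mechanism $\mathcal M$ there is a dataset $D\in\mathcal D^n$ such that, with probability at least $1/4$ over the randomness of $\mathcal M$,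 $$\|\mathcal M(D)-\bar D\|_2\ \ge\ c\,\min\Bigl\{1,\ \frac{\sqrt{d\log(1/\delta)}}{\varepsilon n\,\log(d)\,\log(nd)}\Bigr\}.$$ That is, the error is $\tilde\Omega\bigl(\min\{1,\sqrt{d\log(1/\delta)}/(\varepsilon n)\}\bigr)$, where $\tilde\Omega$ hides polylogarithmic factors in $n$ and $d$ only. (For $d=1$ the range of $\delta$ is empty.) -/

import Mathlib

open MeasureTheory

noncomputable section

/-- The data universe `{-1/√d, 1/√d}^d`, as a set of vectors of `ℝ^d` with the Euclidean norm. -/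
def signCube (d : ℕ) : Set (EuclideanSpace ℝ (Fin d)) :=
  {x | ∀ j, x j = -(1 / √(d : ℝ)) ∨ x j = 1 / √(d : ℝ)}

/-- Datasets of `n` records, each a point of `{-1/√d, 1/√d}^d`. -/
abbrev Dataset (n d : ℕ) : Type := Fin n → signCube d

/-- Neighboring datasets: they differ in at most one record. -/
def Neighboring {n d : ℕ} (D D' : Dataset n d) : Prop :=
  {i | D i ≠ D' i}.Subsingleton

/-- A randomized mechanism with outputs in `ℝ^d`: `M D` is the law of the output on input `D`. -/
abbrev Mechanism (n d : ℕ) : Type :=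
  Dataset n d → ProbabilityMeasure (EuclideanSpace ℝ (Fin d))

/-- `(ε, δ)`-differential privacy. -/
def IsDP {n d : ℕ} (ε δ : ℝ) (M : Mechanism n d) : Prop :=
  ∀ D D' : Dataset n d, Neighboring D D' →
    ∀ S : Set (EuclideanSpace ℝ (Fin d)), MeasurableSet S →
      (M D : Measure (EuclideanSpace ℝ (Fin d))).real S ≤
        Real.exp ε * (M D' : Measure (EuclideanSpace ℝ (Fin d))).real S + δ

/-- The empirical mean `(1/n) ∑ xᵢ` of a dataset. -/
def empMean {n d : ℕ} (D : Dataset n d) : EuclideanSpace ℝ (Fin d) :=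
  (n : ℝ)⁻¹ • ∑ i, (D i : EuclideanSpace ℝ (Fin d))

end

/-!
Fix a base dataset and replace `k ≈ min {n, d / ε}` of its records by copies of a vertex `v` of
the cube, which gives one dataset for each of the `2 ^ d` vertices. Suppose that on each of them
the error is less than `k / (4 n)` with probability more than `3 / 4`. By group privacy, the event
that the output is that close to the mean of the dataset of `v` still has probability at least
`3 / 4 * e ^ (-k ε) - k δ` under the law of the mechanism on the *base* dataset, and the upper
bound on `δ` makes `k δ` negligible. These events overlap little: an output close to the means of
the datasets of both `v` and `w` forces `v` and `w` to be within Hamming distance `d / 16`, and a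
Hamming ball of that radius has at most `(4 / 3) ^ d` points. So the `2 ^ d` probabilities add up
to at most `(4 / 3) ^ d`, which is a contradiction when `k ε ≤ d / 8`. The error is thus of order
`k / n ≈ min {1, d / (ε n)}`, and the lower bound on `δ` says that `√(d log (1 / δ))` is at most
`d`, up to logarithms.
-/

section HammingBall

open Finset

variable {ι : Type*} [Fintype ι] {β : ι → Type*} [∀ i, DecidableEq (β i)]

theorem pow_hammingDist_eq_prod {R : Type*} [CommMonoid R] (v w : ∀ i, β i) (t : R) :
    t ^ hammingDist v w = ∏ i, if v i ≠ w i then t else 1 := by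
  rw [hammingDist, ← prod_filter, prod_const]

variable [DecidableEq ι] [∀ i, Fintype (β i)]

theorem sum_pow_hammingDist {R : Type*} [CommRing R] (v : ∀ i, β i) (t : R) :
    ∑ w, t ^ hammingDist v w = ∏ i, (1 + (Fintype.card (β i) - 1) * t) := by
  have sum_coord (i : ι) :
      ∑ b, (if v i ≠ b then t else 1) = 1 + (Fintype.card (β i) - 1) * t := by
    rw [← add_sum_erase _ _ (mem_univ (v i)),
      sum_congr rfl fun b hb => if_pos (ne_of_mem_erase hb).symm]
    simp [card_erase_of_mem, Nat.cast_sub (Fintype.card_pos_iff.2 ⟨v i⟩)]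
  calc ∑ w, t ^ hammingDist v w
      = ∑ w : ∀ i, β i, ∏ i, if v i ≠ w i then t else 1 := by simp_rw [pow_hammingDist_eq_prod]
    _ = ∏ i, ∑ b, if v i ≠ b then t else 1 := by rw [prod_univ_sum, Fintype.piFinset_univ]
    _ = ∏ i, (1 + (Fintype.card (β i) - 1) * t) := by simp_rw [sum_coord]

theorem card_hammingBall_mul_pow_le {R : Type*} [CommRing R] [PartialOrder R] [IsOrderedRing R]
    (v : ∀ i, β i) (r : ℕ) {t : R} (ht₀ : 0 ≤ t) (ht₁ : t ≤ 1) :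
    (#{w | hammingDist v w ≤ r} : R) * t ^ r ≤ ∏ i, (1 + (Fintype.card (β i) - 1) * t) :=
  calc (#{w | hammingDist v w ≤ r} : R) * t ^ r
      = ∑ w with hammingDist v w ≤ r, t ^ r := by rw [sum_const, nsmul_eq_mul]
    _ ≤ ∑ w with hammingDist v w ≤ r, t ^ hammingDist v w :=
        sum_le_sum fun _ hw => pow_le_pow_of_le_one ht₀ ht₁ (mem_filter.1 hw).2
    _ ≤ ∑ w, t ^ hammingDist v w :=
        sum_le_sum_of_subset_of_nonneg (subset_univ _) fun _ _ _ => pow_nonneg ht₀ _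
    _ = ∏ i, (1 + (Fintype.card (β i) - 1) * t) := sum_pow_hammingDist v t

theorem card_hammingBall_bool_le (v : ι → Bool) {r : ℕ} (hr : 16 * r ≤ Fintype.card ι) :
    (#{w | hammingDist v w ≤ r} : ℝ) ≤ (4 / 3) ^ Fintype.card ι := by
  -- `(5 / 6) ^ 16` is close to the minimiser `1 / 15` of `(1 + t) / t ^ (1 / 16)`, and its 16th
  -- root is rational.
  have chernoff : (#{w | hammingDist v w ≤ r} : ℝ) * ((5 / 6) ^ 16) ^ r
      ≤ (1 + (5 / 6) ^ 16) ^ Fintype.card ι := by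
    have := card_hammingBall_mul_pow_le v r (t := (5 / 6 : ℝ) ^ 16) (by norm_num) (by norm_num)
    rwa [prod_const, Fintype.card_bool, card_univ,
      show ((2 : ℕ) : ℝ) - 1 = 1 by norm_num, one_mul] at this
  refine le_of_mul_le_mul_right ?_ (by positivity : (0 : ℝ) < (5 / 6) ^ Fintype.card ι)
  calc (#{w | hammingDist v w ≤ r} : ℝ) * (5 / 6) ^ Fintype.card ι
      ≤ #{w | hammingDist v w ≤ r} * ((5 / 6) ^ 16) ^ r := by
        rw [← pow_mul]
        gcongr ?_ * ?_
        exact pow_le_pow_of_le_one (by norm_num) (by norm_num) hr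
    _ ≤ (1 + (5 / 6) ^ 16) ^ Fintype.card ι := chernoff
    _ ≤ (4 / 3 * (5 / 6)) ^ Fintype.card ι := by gcongr; norm_num
    _ = (4 / 3) ^ Fintype.card ι * (5 / 6) ^ Fintype.card ι := mul_pow ..

end HammingBall

theorem sum_measureReal_le_of_ncard_le {Ω ι : Type*} [MeasurableSpace Ω] [Fintype ι]
    (μ : Measure Ω) [IsFiniteMeasure μ] {B : ι → Set Ω} (hB : ∀ i, MeasurableSet (B i)) {V : ℝ}
    (hV : ∀ y, ({i | y ∈ B i}.ncard : ℝ) ≤ V) :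
    ∑ i, μ.real (B i) ≤ μ.real Set.univ * V := by
  classical
  have integrable (i : ι) : Integrable ((B i).indicator (1 : Ω → ℝ)) μ :=
    (integrable_const 1).indicator (hB i)
  have overlap (y : Ω) : ∑ i, (B i).indicator (1 : Ω → ℝ) y ≤ V := by
    simpa [Set.indicator_apply, Set.ncard_eq_toFinset_card'] using hV y
  calc ∑ i, μ.real (B i) = ∑ i, ∫ y, (B i).indicator (1 : Ω → ℝ) y ∂μ := by
        simp_rw [fun i => integral_indicator_one (μ := μ) (hB i)]
    _ = ∫ y, ∑ i, (B i).indicator (1 : Ω → ℝ) y ∂μ :=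
        (integral_finsetSum _ fun i _ => integrable i).symm
    _ ≤ ∫ _, V ∂μ :=
        integral_mono (integrable_finsetSum _ fun i _ => integrable i) (integrable_const V) overlap
    _ = μ.real Set.univ * V := by rw [integral_const, smul_eq_mul]

theorem ncard_setOf_update_ne_lt {ι : Type*} [Finite ι] [DecidableEq ι] {β : ι → Type*}
    {f g : ∀ i, β i} {i : ι} (hi : f i ≠ g i) :
    {j | Function.update f i (g i) j ≠ g j}.ncard < {j | f j ≠ g j}.ncard := by
  have : {j | Function.update f i (g i) j ≠ g j} = {j | f j ≠ g j} \ {i} := by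
    ext j
    obtain rfl | hji := eq_or_ne j i <;> simp [*]
  rw [this]
  exact Set.ncard_sdiff_singleton_lt_of_mem hi

section Privacy

variable {n d : ℕ} {ε δ : ℝ} {M : Mechanism n d}

theorem IsDP.delta_nonneg (hM : IsDP ε δ M) (D : Dataset n d) : 0 ≤ δ := by
  simpa using hM D D (by simp [Neighboring]) ∅ .empty

theorem neighboring_update (D : Dataset n d) (i : Fin n) (x : signCube d) :
    Neighboring D (Function.update D i x) := by
  refine Set.subsingleton_of_subset_singleton (a := i) fun j hj => ?_
  by_contra hji
  exact hj (Function.update_of_ne hji _ _).symm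

theorem IsDP.measureReal_le_of_ncard_le (hM : IsDP ε δ M) (hε : 0 ≤ ε) {k : ℕ} {D D' : Dataset n d}
    (hk : {i | D i ≠ D' i}.ncard ≤ k) {S : Set (EuclideanSpace ℝ (Fin d))} (hS : MeasurableSet S) :
    (M D : Measure (EuclideanSpace ℝ (Fin d))).real S
      ≤ Real.exp (k * ε)
        * ((M D' : Measure (EuclideanSpace ℝ (Fin d))).real S + k * δ) := by
  have hδ : 0 ≤ δ := hM.delta_nonneg D
  induction k generalizing D with
  | zero =>
    have no_change : {i | D i ≠ D' i} = ∅ := (Set.ncard_eq_zero).1 (Nat.le_zero.1 hk)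
    have hDD' : D = D' := funext fun i => by
      simpa using Set.eq_empty_iff_forall_notMem.1 no_change i
    simp [hDD']
  | succ k ih =>
    obtain hDD' | ⟨i, hi⟩ := {i | D i ≠ D' i}.eq_empty_or_nonempty
    · refine (ih (by simp [hDD'])).trans ?_
      gcongr <;> simp
    let D₁ : Dataset n d := Function.update D i (D' i)
    have hD₁D' : {j | D₁ j ≠ D' j}.ncard ≤ k :=
      Nat.le_of_lt_succ ((ncard_setOf_update_ne_lt hi).trans_le hk)
    have exp_succ : Real.exp ((k + 1 : ℕ) * ε) = Real.exp ε * Real.exp (k * ε) := by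
      rw [← Real.exp_add]; push_cast; ring_nf
    have one_le_exp : 1 ≤ Real.exp ε * Real.exp (k * ε) := by
      rw [← exp_succ]; exact Real.one_le_exp (by positivity)
    calc (M D : Measure (EuclideanSpace ℝ (Fin d))).real S
        ≤ Real.exp ε * (M D₁ : Measure (EuclideanSpace ℝ (Fin d))).real S + δ :=
          hM _ _ (neighboring_update D i (D' i)) S hS
      _ ≤ Real.exp ε * (Real.exp (k * ε)
            * ((M D' : Measure (EuclideanSpace ℝ (Fin d))).real S + k * δ))
          + Real.exp ε * Real.exp (k * ε) * δ := by
          gcongr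
          · exact ih hD₁D'
          · exact le_mul_of_one_le_left hδ one_le_exp
      _ = Real.exp ((k + 1 : ℕ) * ε)
            * ((M D' : Measure (EuclideanSpace ℝ (Fin d))).real S + (k + 1 : ℕ) * δ) := by
          rw [exp_succ]; push_cast; ring

theorem IsDP.exists_le_measureReal_of_packing {ι : Type*} [Fintype ι] [Nonempty ι] {k : ℕ}
    {β r V : ℝ} (hM : IsDP ε δ M) (hε : 0 ≤ ε) {D₀ : Dataset n d} {D : ι → Dataset n d}
    (hD : ∀ v, {i | D v i ≠ D₀ i}.ncard ≤ k) (θ : ι → EuclideanSpace ℝ (Fin d))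
    (hV : ∀ v, ({w | dist (θ v) (θ w) < 2 * r}.ncard : ℝ) ≤ V)
    (hcard : V < Fintype.card ι * ((1 - β) * Real.exp (-(k * ε)) - k * δ)) :
    ∃ v, β ≤ (M (D v) : Measure (EuclideanSpace ℝ (Fin d))).real {y | r ≤ ‖y - θ v‖} := by
  by_contra! hβ
  let μ₀ := (M D₀ : Measure (EuclideanSpace ℝ (Fin d)))
  have ball_mass (v : ι) :
      (1 - β) * Real.exp (-(k * ε)) - k * δ ≤ μ₀.real (Metric.ball (θ v) r) := by
    have compl_ball : (Metric.ball (θ v) r)ᶜ = {y | r ≤ ‖y - θ v‖} := by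
      ext y; simp [dist_eq_norm]
    have mass_own : 1 - β ≤
        (M (D v) : Measure (EuclideanSpace ℝ (Fin d))).real (Metric.ball (θ v) r) := by
      have := probReal_compl_eq_one_sub (μ := (M (D v) : Measure (EuclideanSpace ℝ (Fin d))))
        (measurableSet_ball (x := θ v) (ε := r))
      rw [compl_ball] at this
      linarith [hβ v]
    have := mass_own.trans (hM.measureReal_le_of_ncard_le hε (hD v) measurableSet_ball)
    rw [sub_le_iff_le_add, Real.exp_neg, ← div_eq_mul_inv]
    exact (div_le_iff₀' (Real.exp_pos _)).2 this
  have overlap (y : EuclideanSpace ℝ (Fin d)) :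
      ({v | y ∈ Metric.ball (θ v) r}.ncard : ℝ) ≤ V := by
    obtain hempty | ⟨v, hv⟩ := {v | y ∈ Metric.ball (θ v) r}.eq_empty_or_nonempty
    · rw [hempty, Set.ncard_empty, Nat.cast_zero]
      exact (Nat.cast_nonneg _).trans (hV (Classical.arbitrary ι))
    · refine le_trans (Nat.cast_le.2 (Set.ncard_le_ncard fun w hw => ?_)) (hV v)
      calc dist (θ v) (θ w) ≤ dist y (θ v) + dist y (θ w) := dist_triangle_left _ _ _
        _ < r + r := add_lt_add hv hw
        _ = 2 * r := (two_mul r).symm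
  have sum_le : ∑ v, μ₀.real (Metric.ball (θ v) r) ≤ V := by
    simpa using sum_measureReal_le_of_ncard_le μ₀ (fun _ => measurableSet_ball) overlap
  have le_sum := Finset.card_nsmul_le_sum Finset.univ _ _ fun v _ => ball_mass v
  rw [nsmul_eq_mul, Finset.card_univ] at le_sum
  linarith

end Privacy

section Cube

variable {n d : ℕ}

/-- The vertex of the cube `{-1/√d, 1/√d}^d` with sign pattern `v`, where `true` stands for `+`;
these vertices are the points packed in the lower bound. -/
noncomputable def signVec (v : Fin d → Bool) : signCube d :=
  ⟨WithLp.toLp 2 fun j => if v j then 1 / √(d : ℝ) else -(1 / √(d : ℝ)), fun j => by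
    by_cases h : v j <;> simp [h]⟩

theorem norm_signVec_sub_sq (v w : Fin d → Bool) :
    ‖(signVec v - signVec w : EuclideanSpace ℝ (Fin d))‖ ^ 2 = 4 * hammingDist v w / d := by
  have coord (j : Fin d) : ‖(signVec v - signVec w : EuclideanSpace ℝ (Fin d)) j‖ ^ 2
      = if v j ≠ w j then 4 / (d : ℝ) else 0 := by
    have inv_sqrt_sq : (√(d : ℝ))⁻¹ ^ 2 = (d : ℝ)⁻¹ := by
      rw [inv_pow, Real.sq_sqrt d.cast_nonneg]
    rw [Real.norm_eq_abs, sq_abs]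
    cases hv : v j <;> cases hw : w j <;> simp [signVec, hv, hw] <;>
      linear_combination 4 * inv_sqrt_sq
  rw [EuclideanSpace.norm_sq_eq, Finset.sum_congr rfl fun j _ => coord j, ← Finset.sum_filter,
    Finset.sum_const, nsmul_eq_mul, hammingDist]
  ring

theorem ncard_norm_signVec_sub_lt_le (v : Fin d → Bool) :
    ({w : Fin d → Bool | ‖(signVec v - signVec w : EuclideanSpace ℝ (Fin d))‖ < 1 / 2}.ncard : ℝ)
      ≤ (4 / 3) ^ d := by
  have subset_hammingBall :
      {w : Fin d → Bool | ‖(signVec v - signVec w : EuclideanSpace ℝ (Fin d))‖ < 1 / 2}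
        ⊆ ({w | hammingDist v w ≤ d / 16} : Finset (Fin d → Bool)) := fun w hw => by
    suffices hammingDist v w * 16 ≤ d by simpa [Nat.le_div_iff_mul_le] using this
    obtain rfl | hd := d.eq_zero_or_pos
    · simp [Subsingleton.elim v w]
    have hsq := pow_le_pow_left₀ (norm_nonneg _) (le_of_lt hw) 2
    rw [norm_signVec_sub_sq, div_le_iff₀ (by exact_mod_cast hd)] at hsq
    have : (hammingDist v w * 16 : ℝ) ≤ d := by linarith
    exact_mod_cast this
  refine (Nat.cast_le.2 (Set.ncard_le_ncard subset_hammingBall)).trans ?_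
  rw [Set.ncard_coe_finset]
  simpa using card_hammingBall_bool_le v (r := d / 16) (by simpa using Nat.mul_div_le d 16)

theorem empMean_piecewise_sub (s : Finset (Fin n)) (x x' : signCube d) (D : Dataset n d) :
    empMean (s.piecewise (fun _ => x) D) - empMean (s.piecewise (fun _ => x') D)
      = ((s.card : ℝ) / n) • ((x : EuclideanSpace ℝ (Fin d)) - x') := by
  have record_sub (i : Fin n) :
      ((s.piecewise (fun _ => x) D i : EuclideanSpace ℝ (Fin d))
        - s.piecewise (fun _ => x') D i)
        = if i ∈ s then (x : EuclideanSpace ℝ (Fin d)) - x' else 0 := by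
    by_cases hi : i ∈ s <;> simp [hi]
  rw [empMean, empMean, ← smul_sub, ← Finset.sum_sub_distrib,
    Finset.sum_congr rfl fun i _ => record_sub i, Finset.sum_ite_mem, Finset.univ_inter,
    Finset.sum_const, ← Nat.cast_smul_eq_nsmul ℝ, smul_smul, div_eq_inv_mul]

end Cube

theorem four_thirds_pow_lt {d : ℕ} (hd : 2 ≤ d) :
    (4 / 3 : ℝ) ^ d < 2 ^ d * (3 / 4 * (7 / 8) ^ d - 4 / 7 ^ d) := by
  have merged : (4 / 3 : ℝ) ^ d + 4 * (2 / 7) ^ d < 3 / 4 * (7 / 4) ^ d := by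
    induction d, hd using Nat.le_induction with
    | base => norm_num
    | succ d _ ih =>
      have : (0 : ℝ) < (2 / 7) ^ d := by positivity
      have : (0 : ℝ) < (7 / 4) ^ d := by positivity
      rw [pow_succ, pow_succ, pow_succ]
      linarith
  have hexp : (2 : ℝ) ^ d * (7 / 8) ^ d = (7 / 4) ^ d := by rw [← mul_pow]; norm_num
  have hdelta : (2 : ℝ) ^ d * (4 / 7 ^ d) = 4 * (2 / 7) ^ d := by rw [div_pow]; ring
  linear_combination merged - 3 / 4 * hexp + hdelta

theorem seven_eighths_pow_le_exp (d : ℕ) : (7 / 8 : ℝ) ^ d ≤ Real.exp (-(d / 8)) :=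
  calc (7 / 8 : ℝ) ^ d ≤ Real.exp (-(1 / 8)) ^ d := by
        gcongr; linarith [Real.one_sub_le_exp_neg (1 / 8)]
    _ = Real.exp (-(d / 8)) := by rw [← Real.exp_nat_mul]; ring_nf

section LowerBound

variable {n d : ℕ} {ε δ : ℝ} {M : Mechanism n d}

theorem IsDP.exists_error_ge_div {k : ℕ} (hM : IsDP ε δ M) (hd : 2 ≤ d) (hkn : k ≤ n) (hε : 0 ≤ ε)
    (hkε : k * ε ≤ d / 8) (hkδ : k * δ ≤ 4 / 7 ^ d) :
    ∃ D : Dataset n d, 1 / 4 ≤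
      (M D : Measure (EuclideanSpace ℝ (Fin d))).real {y | k / (4 * n) ≤ ‖y - empMean D‖} := by
  obtain ⟨s, -, hs⟩ := Finset.exists_subset_card_eq (s := (Finset.univ : Finset (Fin n)))
    (hkn.trans_eq (Finset.card_fin n).symm)
  let D₀ : Dataset n d := fun _ => signVec fun _ => true
  let D (v : Fin d → Bool) : Dataset n d := s.piecewise (fun _ => signVec v) D₀
  have hD (v : Fin d → Bool) : {i | D v i ≠ D₀ i}.ncard ≤ k := by
    rw [← hs, ← Set.ncard_coe_finset]
    refine Set.ncard_le_ncard fun i hi => ?_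
    by_contra his
    exact hi (s.piecewise_eq_of_notMem _ _ his)
  have hV (v : Fin d → Bool) :
      ({w | dist (empMean (D v)) (empMean (D w)) < 2 * (k / (4 * n))}.ncard : ℝ)
        ≤ (4 / 3) ^ d := by
    refine le_trans (Nat.cast_le.2 (Set.ncard_le_ncard fun w hw => ?_))
      (ncard_norm_signVec_sub_lt_le v)
    have hkn₀ : (0 : ℝ) ≤ k / n := by positivity
    rw [Set.mem_ofPred_eq, dist_eq_norm, empMean_piecewise_sub, hs, norm_smul,
      Real.norm_of_nonneg hkn₀, show (2 * (k / (4 * n)) : ℝ) = k / n * (1 / 2) by ring] at hw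
    exact lt_of_mul_lt_mul_left hw hkn₀
  have hexp : (7 / 8 : ℝ) ^ d ≤ Real.exp (-(k * ε)) :=
    (seven_eighths_pow_le_exp d).trans (by gcongr)
  have hcard : (4 / 3 : ℝ) ^ d
      < Fintype.card (Fin d → Bool) * ((1 - 1 / 4) * Real.exp (-(k * ε)) - k * δ) := by
    refine (four_thirds_pow_lt hd).trans_le ?_
    simp only [Fintype.card_pi, Fintype.card_bool, Finset.prod_const, Finset.card_univ,
      Fintype.card_fin, Nat.cast_pow, Nat.cast_ofNat]
    gcongr
    norm_num
  obtain ⟨v, hv⟩ := hM.exists_le_measureReal_of_packing hε hD (fun v => empMean (D v)) hV hcard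
  exact ⟨D v, hv⟩

theorem theorem10_general (hn : 1 ≤ n) (hd : 2 ≤ d) (hε : 0 < ε) (hεd : ε ≤ d / 8)
    (hnδ : n * δ ≤ 4 / 7 ^ d) (hM : IsDP ε δ M) :
    ∃ D : Dataset n d, 1 / 4 ≤ (M D : Measure (EuclideanSpace ℝ (Fin d))).real
      {y | 1 / 64 * min 1 (d / (ε * n)) ≤ ‖y - empMean D‖} := by
  have hn₀ : (0 : ℝ) < n := by exact_mod_cast hn
  set q : ℝ := d / (8 * ε) with hq
  have one_le_q : 1 ≤ q := by rw [hq, one_le_div (by positivity)]; linarith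
  set k : ℕ := min n ⌊q⌋₊ with hk
  have hkq : (k : ℝ) ≤ q := (Nat.cast_le.2 (min_le_right _ _)).trans (Nat.floor_le (by positivity))
  have hkε : k * ε ≤ d / 8 :=
    calc k * ε ≤ q * ε := by gcongr
      _ = d / 8 := by rw [hq]; field_simp
  have hkδ : k * δ ≤ 4 / 7 ^ d := by
    have hδ : 0 ≤ δ := hM.delta_nonneg fun _ => signVec fun _ => true
    exact (mul_le_mul_of_nonneg_right (Nat.cast_le.2 (min_le_left _ _)) hδ).trans hnδ
  have radius_le : 1 / 64 * min 1 (d / (ε * n)) ≤ (k : ℝ) / (4 * n) := by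
    have hmin : min (n : ℝ) (q / 2) ≤ k := by
      rw [hk, Nat.cast_min]
      exact min_le_min_left _ (Nat.div_two_lt_floor one_le_q).le
    calc 1 / 64 * min 1 (d / (ε * n)) = min (n / 16 : ℝ) (q / 2) / (4 * n) := by
          rw [mul_min_of_nonneg _ _ (by norm_num), ← min_div_div_right (by positivity), hq]
          congr 1 <;> field_simp <;> norm_num
      _ ≤ min (n : ℝ) (q / 2) / (4 * n) := by gcongr; linarith
      _ ≤ k / (4 * n) := by gcongr
  obtain ⟨D, hD⟩ := hM.exists_error_ge_div hd (min_le_left n ⌊q⌋₊) hε.le hkε hkδ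
  exact ⟨D, hD.trans (measureReal_mono fun y hy => radius_le.trans hy)⟩

end LowerBound

section Rates

variable {n d : ℕ} {ε δ : ℝ}

theorem mul_le_of_lt_div_pow_mul_log_pow (hn : 1 ≤ n) (hd : 2 ≤ d)
    (hδ : δ < 4 / ((n : ℝ) ^ d * Real.log (8 * d) ^ (2 * d))) : n * δ ≤ 4 / 7 ^ d := by
  have hn₁ : (1 : ℝ) ≤ n := by exact_mod_cast hn
  have hd₂ : (2 : ℝ) ≤ d := by exact_mod_cast hd
  have seven_le_log_sq : 7 ≤ Real.log (8 * d) ^ 2 := by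
    have log_sixteen : Real.log 16 = 4 * Real.log 2 := by
      rw [show (16 : ℝ) = 2 ^ 4 by norm_num, Real.log_pow, Nat.cast_ofNat]
    have : Real.log 16 ≤ Real.log (8 * d) := Real.log_le_log (by norm_num) (by linarith)
    nlinarith [Real.log_two_gt_d9]
  have n_le_pow : (n : ℝ) ≤ n ^ d := le_self_pow₀ hn₁ (by omega)
  calc n * δ ≤ n * (4 / ((n : ℝ) ^ d * Real.log (8 * d) ^ (2 * d))) := by gcongr
    _ ≤ n * (4 / (n * 7 ^ d)) := by rw [pow_mul]; gcongr
    _ = 4 / 7 ^ d := by field_simp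

theorem sqrt_mul_log_inv_le (hd : 2 ≤ d)
    (hδ : Real.exp (-(4 * d * Real.log d * Real.log (n * d) ^ 2)) < δ) :
    √(d * Real.log (1 / δ)) ≤ 4 * d * (Real.log d * Real.log (n * d)) := by
  have hd₂ : (2 : ℝ) ≤ d := by exact_mod_cast hd
  have half_lt_log : 1 / 2 < Real.log d :=
    calc 1 / 2 < Real.log 2 := by linarith [Real.log_two_gt_d9]
      _ ≤ Real.log d := Real.log_le_log (by norm_num) hd₂
  have log_nonneg : 0 ≤ Real.log (n * d) := by exact_mod_cast Real.log_natCast_nonneg (n * d)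
  have log_inv_le : Real.log (1 / δ) ≤ 4 * d * Real.log d * Real.log (n * d) ^ 2 := by
    rw [one_div, Real.log_inv]
    linarith [(Real.lt_log_iff_exp_lt ((Real.exp_pos _).trans hδ)).2 hδ]
  refine Real.sqrt_le_iff.2 ⟨by positivity, ?_⟩
  calc d * Real.log (1 / δ) ≤ d * (4 * d * Real.log d * Real.log (n * d) ^ 2) := by gcongr
    _ = (4 * d ^ 2 * Real.log d * Real.log (n * d) ^ 2) * 1 := by ring
    _ ≤ (4 * d ^ 2 * Real.log d * Real.log (n * d) ^ 2) * (4 * Real.log d) := by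
        gcongr; linarith
    _ = (4 * d * (Real.log d * Real.log (n * d))) ^ 2 := by ring

theorem min_one_rate_le (hn : 1 ≤ n) (hd : 2 ≤ d) (hε : 0 < ε)
    (hδ : Real.exp (-(4 * d * Real.log d * Real.log (n * d) ^ 2)) < δ) :
    1 / 256 * min 1 (√(d * Real.log (1 / δ)) / (ε * n * (Real.log d * Real.log (n * d))))
      ≤ 1 / 64 * min 1 (d / (ε * n)) := by
  have hn₁ : (1 : ℝ) ≤ n := by exact_mod_cast hn
  have hd₂ : (2 : ℝ) ≤ d := by exact_mod_cast hd
  have logs_pos : 0 < Real.log d * Real.log (n * d) :=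
    mul_pos (Real.log_pos (by linarith)) (Real.log_pos (by nlinarith))
  have rate_le : √(d * Real.log (1 / δ)) / (ε * n * (Real.log d * Real.log (n * d)))
      ≤ 4 * (d / (ε * n)) := by
    rw [mul_comm (ε * n), ← div_div, ← mul_div_assoc]
    gcongr
    exact (div_le_iff₀ logs_pos).2 (sqrt_mul_log_inv_le hd hδ)
  calc 1 / 256 * min 1 (√(d * Real.log (1 / δ)) / (ε * n * (Real.log d * Real.log (n * d))))
      ≤ 1 / 256 * min (4 * 1) (4 * (d / (ε * n))) := by gcongr; norm_num
    _ = 1 / 64 * min 1 (d / (ε * n)) := by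
        rw [← mul_min_of_nonneg _ _ (by norm_num)]; ring

theorem two_le_of_exp_lt_of_lt_div (hn : 1 ≤ n) (hd : 1 ≤ d)
    (hδl : Real.exp (-(4 * d * Real.log d * Real.log (n * d) ^ 2)) < δ)
    (hδu : δ < 4 / ((n : ℝ) ^ d * Real.log (8 * d) ^ (2 * d))) : 2 ≤ d := by
  by_contra hlt
  obtain rfl : d = 1 := by omega
  have hn₁ : (1 : ℝ) ≤ n := by exact_mod_cast hn
  have four_le_log_sq : 4 ≤ Real.log 8 ^ 2 := by
    have log_eight : Real.log 8 = 3 * Real.log 2 := by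
      rw [show (8 : ℝ) = 2 ^ 3 by norm_num, Real.log_pow, Nat.cast_ofNat]
    nlinarith [Real.log_two_gt_d9]
  simp only [Nat.cast_one, Real.log_one, mul_zero, zero_mul, neg_zero, Real.exp_zero, mul_one,
    pow_one] at hδl hδu
  have := hδl.trans hδu
  rw [one_lt_div (by positivity)] at this
  nlinarith

end Rates

/-- Lower bound for `(ε, δ)`-DP mean estimation with exponentially small `δ`. The constants `κ`, `c`
are absolute. The range `ε ≤ κ d` contains every `ε ≤ κ` for all `d`, and every `ε ≤ C`, for any
fixed `C`, as soon as `d ≥ C / κ`. -/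
theorem theorem10 :
    ∃ κ : ℝ, 0 < κ ∧ ∃ c : ℝ, 0 < c ∧
      ∀ n d : ℕ, 1 ≤ n → 1 ≤ d →
      ∀ ε δ : ℝ, 0 < ε → ε ≤ κ * d →
      Real.exp (-(4 * d * Real.log d * Real.log (n * d) ^ 2)) < δ →
      δ < 4 / ((n : ℝ) ^ d * Real.log (8 * d) ^ (2 * d)) →
      ∀ M : Mechanism n d, IsDP ε δ M →
      ∃ D : Dataset n d,
        1 / 4 ≤ (M D : MeasureTheory.Measure (EuclideanSpace ℝ (Fin d))).real
          {y | c * min 1 (√(d * Real.log (1 / δ)) / (ε * n * (Real.log d * Real.log (n * d))))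
                ≤ ‖y - empMean D‖} := by
  refine ⟨1 / 8, by norm_num, 1 / 256, by norm_num, ?_⟩
  intro n d hn hd ε δ hε hεd hδl hδu M hM
  have hd₂ : 2 ≤ d := two_le_of_exp_lt_of_lt_div hn hd hδl hδu
  obtain ⟨D, hD⟩ := theorem10_general hn hd₂ hε (hεd.trans_eq (by ring))
    (mul_le_of_lt_div_pow_mul_log_pow hn hd₂ hδu) hM
  exact ⟨D, hD.trans (measureReal_mono fun y hy => (min_one_rate_le hn hd₂ hε hδl).trans hy)⟩
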